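/- Consider a wireless amplify-and-forward network with $K\ge 1$ transmitters, $R\ge 1$ parallel relays, $L\ge 1$ receivers and no direct links. The channels $f_{kr}\sim\mathcal{CN}(0,\sigma_{f_{kr}}^2)$ (transmitter $k$ to relay $r$) and $g_{r\ell}\sim\mathcal{CN}(0,\sigma_{g_{r\ell}}^2)$ (relay $r$ to receiver $\ell$) are independent with positive finite variances; $\mathbf h$ denotes the vector of all of them. The transmitted symbols $s_k$ are independent and uniform on finite constellations $\mathcal S_k\subset\mathbb C$ with $\mathtt E|s_k|^2=1$, at least one of which has two or more points. The powers are $P_{S_k}=p_{S_k}P$ and $P_{R_r}=p_{R_r}P$ with fixed $p_{S_k},p_{R_r}\in(0,\infty)$. For a beamforming vector $\mathbf x\in\mathbb C^R$ and a normalization factor $\rho=(\rho_1,\dots,\rho_R)$, receiver $\ell$ observes $$y_\ell=\sum_{k=1}^K\sum_{r=1}^R x_r\sqrt{\rho_r}\,f_{kr}g_{r\ell}\sqrt{P_{S_k}}\,s_k+\sum_{r=1}^R x_rg_{r\ell}\sqrt{\rho_r}\,\eta_{0r}+\eta_{1\ell},$$ with independent noises $\eta_{0r},\eta_{1\ell}\sim\mathcal{CN}(0,1)$;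 the standard factor is $\rho_r(\mathbf h)=P_{R_r}/(1+\sum_{i=1}^K|f_{ir}|^2P_{S_i})$. Receiver $\ell$ decodes $\mathbf s_\ell=(s_k)_{k\in\mathcal D_\ell}$, where the sets $\mathcal D_\ell\ne\emptyset$ have union $\{1,\dots,K\}$, by maximizing the a posteriori probability of $\mathbf s_\ell$ given $y_\ell$, $\mathbf x$ and $\mathbf h$ (ties are broken by a fixed ordering). Let $\mathtt{CNER}(\mathbf x,\mathbf h)$ be the probability that at least one receiver decodes incorrectly, and for a quantizer $\mathtt Q:\mathbb C^{R(K+L)}\to\mathcal C$ (global or local) let $\mathtt{NER}(\mathtt Q)=\mathtt E_{\mathbf h}[\mathtt{CNER}(\mathtt Q(\mathbf h),\mathbf h)]$. Let $\mathcal X=\{\mathbf x\in\mathbb C^R:\|\mathbf x\|_\infty\le 1\}$. There are constants $0<C_1,C_2<\infty$ and a threshold $P_0$, depending on the network parameters only and not on $P$ or $\mathtt Q$, such that for all $P\ge P_0$ and every quantizer $\mathtt Q:\mathbb C^{R(K+L)}\to\mathcal C$ with $\mathcal C\subset\mathcal X$ (which may be chosen depending on $P$), $$\mathtt{NER}(\mathtt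 Q)\ \ge\ C_1\frac1{P^R}\quad\text{if }K=1,\qquad \mathtt{NER}(\mathtt Q)\ \ge\ C_2\frac{\log^R P}{P^R}\quad\text{if }K>1 .$$ The same bounds, with the same constants and threshold, hold if the network uses, instead of $\rho_r$, any normalization factor $\rho_r'$, a function of $\mathbf h$ (and $P$) with $0\le\rho_r'\le\rho_r$ for all $r$ and $\mathbf h$. Consequently no such quantizer (or family of quantizers indexed by $P$), with any such normalization factor, has diversity higher than $(R,0)$ if $K=1$, or higher than $(R,-R)$ if $K>1$. Here the diversity is the pair $(d_1,d_2)$ of the limits, where they exist, $d_1=\lim_{P\to\infty}-\frac{\log\mathtt{NER}}{\log P}$ and $d_2=\lim_{P\to\infty}-\frac{\log\mathtt{NER}+d_1\log P}{\log\log P}$, and pairs are compared lexicographically. -/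

import Mathlib

open scoped NNReal ENNReal
open MeasureTheory ProbabilityTheory Filter Topology

noncomputable section

/-- The circularly symmetric complex Gaussian law `CN(0, v)`: the real and the imaginary part are
independent real Gaussians with mean `0` and variance `v / 2`. -/
def complexGaussian (v : ℝ≥0) : Measure ℂ :=
  ((gaussianReal 0 (v / 2)).prod (gaussianReal 0 (v / 2))).map
    Complex.measurableEquivRealProd.symm

/-- A channel state `h = (f, g)`: `h.1 k r` is the channel `f_{kr}` from transmitter `k` to
relay `r`, and `h.2 r l` is the channel `g_{rl}` from relay `r` to receiver `l`. -/
abbrev ChannelState (K L R : ℕ) : Type := (Fin K → Fin R → ℂ) × (Fin R → Fin L → ℂ)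

/-- A noise realization: `n.1 r` is the noise at relay `r`, `n.2 l` the noise at receiver `l`. -/
abbrev NoiseState (L R : ℕ) : Type := (Fin R → ℂ) × (Fin L → ℂ)

/-- The noises at the relays and at the receivers are independent and `CN(0, 1)`. -/
def noiseLaw (L R : ℕ) : Measure (NoiseState L R) :=
  (Measure.pi fun _ : Fin R => complexGaussian 1).prod
    (Measure.pi fun _ : Fin L => complexGaussian 1)

/-- The set of all beamforming vectors: the vectors in `ℂ^R` with sup-norm at most `1`
(the norm of `Fin R → ℂ` is the sup-norm). -/
def beamformingVectors (R : ℕ) : Set (Fin R → ℂ) := {x | ‖x‖ ≤ 1}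

/-- A quantizer with codebook contained in the set of beamforming vectors: an arbitrary map from
channel states to the codebook. Global quantizers (encoders that see the whole channel state) and
local quantizers (combinations of encoders that see a part of it) are both such maps. -/
structure Quantizer (K L R : ℕ) where
  codebook : Set (Fin R → ℂ)
  codebook_subset : codebook ⊆ beamformingVectors R
  toFun : ChannelState K L R → Fin R → ℂ
  toFun_mem : ∀ h, toFun h ∈ codebook

/-- The parameters of a relay network with `K` transmitters, `L` receivers and `R` relays. -/
structure RelayNetwork (K L R : ℕ) where
  /-- the constellation of each transmitter -/
  S : Fin K → Finset ℂ
  /-- unit average energy, `E|s_k|² = 1` for `s_k` uniform on the constellation -/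
  S_energy : ∀ k, (∑ s ∈ S k, ‖s‖ ^ 2) / ((S k).card : ℝ) = 1
  /-- there is something to decode: some constellation has at least two points -/
  S_nontrivial : ∃ k, 2 ≤ (S k).card
  /-- `D l` is the set of the transmitters whose symbols receiver `l` wants -/
  D : Fin L → Finset (Fin K)
  D_nonempty : ∀ l, (D l).Nonempty
  D_cover : ∀ k, ∃ l, k ∈ D l
  /-- transmitter `k` has power `pS k * P` -/
  pS : Fin K → ℝ
  pS_pos : ∀ k, 0 < pS k
  /-- relay `r` has power `pR r * P` -/
  pR : Fin R → ℝ
  pR_pos : ∀ r, 0 < pR r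
  /-- the variance of `f_{kr}` -/
  varF : Fin K → Fin R → ℝ≥0
  varF_pos : ∀ k r, 0 < varF k r
  /-- the variance of `g_{rl}` -/
  varG : Fin R → Fin L → ℝ≥0
  varG_pos : ∀ r l, 0 < varG r l
  /-- the ordering by which a decoder breaks ties between maximizers -/
  tie : ∀ l, LinearOrder (D l → ℂ)

namespace RelayNetwork

variable {K L R : ℕ} (N : RelayNetwork K L R)

/-- The channels are independent, `f_{kr} ~ CN(0, varF k r)` and `g_{rl} ~ CN(0, varG r l)`. -/
def channelLaw : Measure (ChannelState K L R) :=
  (Measure.pi fun k => Measure.pi fun r => complexGaussian (N.varF k r)).prod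
    (Measure.pi fun r => Measure.pi fun l => complexGaussian (N.varG r l))

/-- The relay normalization factor `ρ_r = P_{R_r} / (1 + ∑_k |f_{kr}|² P_{S_k})`. -/
def relayFactor (P : ℝ) (h : ChannelState K L R) (r : Fin R) : ℝ :=
  (N.pR r * P) / (1 + ∑ k, ‖h.1 k r‖ ^ 2 * (N.pS k * P))

/-- A relay normalization factor `ρ'`, a nonnegative function of the channel state, that is at
most `ρ` for every channel state. -/
def IsAdmissibleFactor (P : ℝ) (ρ' : ChannelState K L R → Fin R → ℝ) : Prop :=
  ∀ h r, 0 ≤ ρ' h r ∧ ρ' h r ≤ N.relayFactor P h r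

/-- The set of the possible vectors of transmitted symbols. -/
def symbolVectors : Finset (Fin K → ℂ) := Fintype.piFinset N.S

/-- The alphabet of the super-symbols relevant to receiver `l`. -/
def superAlphabet (l : Fin L) : Finset (N.D l → ℂ) := Fintype.piFinset fun k => N.S k

/-- The part of a vector of symbols that receiver `l` wants. -/
def superSymbol (l : Fin L) (s : Fin K → ℂ) : N.D l → ℂ := fun k => s k

/-- The noiseless part of the signal at receiver `l`,
`∑_k ∑_r x_r √ρ_r f_{kr} g_{rl} √P_{S_k} s_k`. -/
def signal (P : ℝ) (ρ : Fin R → ℝ) (x : Fin R → ℂ) (h : ChannelState K L R) (l : Fin L)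
    (s : Fin K → ℂ) : ℂ :=
  ∑ k, ∑ r, x r * (√(ρ r) : ℂ) * h.1 k r * h.2 r l * (√(N.pS k * P) : ℂ) * s k

/-- The signal received at receiver `l`. -/
def received (P : ℝ) (ρ : Fin R → ℝ) (x : Fin R → ℂ) (h : ChannelState K L R) (l : Fin L)
    (s : Fin K → ℂ) (n : NoiseState L R) : ℂ :=
  N.signal P ρ x h l s + ∑ r, x r * h.2 r l * (√(ρ r) : ℂ) * n.1 r + n.2 l

/-- The variance of the total noise `∑_r x_r g_{rl} √ρ_r η_{0r} + η_{1l}` at receiver `l`. -/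
def noiseVar (ρ : Fin R → ℝ) (x : Fin R → ℂ) (h : ChannelState K L R) (l : Fin L) : ℝ :=
  1 + ∑ r, ρ r * ‖h.2 r l‖ ^ 2 * ‖x r‖ ^ 2

/-- The density at `y` of the signal received at receiver `l`, given the transmitted vector `s`:
the density of the complex Gaussian law with mean `signal` and variance `noiseVar`. -/
def likelihood (P : ℝ) (ρ : Fin R → ℝ) (x : Fin R → ℂ) (h : ChannelState K L R) (l : Fin L)
    (s : Fin K → ℂ) (y : ℂ) : ℝ :=
  (Real.pi * noiseVar ρ x h l)⁻¹ *
    Real.exp (-(‖y - N.signal P ρ x h l s‖ ^ 2 / noiseVar ρ x h l))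

open Classical in
/-- The a posteriori probability of the super-symbol `u` given the received value `y`
(Bayes' rule; the vectors of symbols are equiprobable, so that the prior cancels). -/
def posterior (P : ℝ) (ρ : Fin R → ℝ) (x : Fin R → ℂ) (h : ChannelState K L R) (l : Fin L)
    (u : N.D l → ℂ) (y : ℂ) : ℝ :=
  (∑ s ∈ N.symbolVectors with N.superSymbol l s = u, N.likelihood P ρ x h l s y) /
    ∑ s ∈ N.symbolVectors, N.likelihood P ρ x h l s y

open Classical in
/-- The super-symbols of maximal a posteriori probability. -/
def maximizers (P : ℝ) (ρ : Fin R → ℝ) (x : Fin R → ℂ) (h : ChannelState K L R) (l : Fin L)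
    (y : ℂ) : Finset (N.D l → ℂ) :=
  {u ∈ N.superAlphabet l | ∀ u' ∈ N.superAlphabet l,
    N.posterior P ρ x h l u' y ≤ N.posterior P ρ x h l u y}

theorem superAlphabet_nonempty (l : Fin L) : (N.superAlphabet l).Nonempty := by
  refine Fintype.piFinset_nonempty.2 fun k => ?_
  by_contra hk
  have h1 := N.S_energy k
  rw [Finset.not_nonempty_iff_eq_empty.1 hk] at h1
  simp at h1

theorem maximizers_nonempty (P : ℝ) (ρ : Fin R → ℝ) (x : Fin R → ℂ) (h : ChannelState K L R)
    (l : Fin L) (y : ℂ) : (N.maximizers P ρ x h l y).Nonempty := by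
  obtain ⟨u, hu, hmax⟩ := Finset.exists_max_image (N.superAlphabet l)
    (fun u => N.posterior P ρ x h l u y) (N.superAlphabet_nonempty l)
  exact ⟨u, by simpa [maximizers] using ⟨hu, hmax⟩⟩

/-- The individual maximum likelihood decoder of receiver `l`: the super-symbol of maximal a
posteriori probability given `y`, the channel state and the beamforming vector, the first one in
the tie-breaking order if there are several. -/
def decode (P : ℝ) (ρ : Fin R → ℝ) (x : Fin R → ℂ) (h : ChannelState K L R) (l : Fin L)
    (y : ℂ) : N.D l → ℂ :=
  @Finset.min' _ (N.tie l) (N.maximizers P ρ x h l y) (N.maximizers_nonempty P ρ x h l y)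

/-- The conditional network error rate: the probability, over the equiprobable vectors of
transmitted symbols and over the noise, that at least one receiver incorrectly decodes its
desired super-symbol. -/
def cner (P : ℝ) (ρ : Fin R → ℝ) (x : Fin R → ℂ) (h : ChannelState K L R) : ℝ≥0∞ :=
  (∑ s ∈ N.symbolVectors, noiseLaw L R
      {n | ∃ l, N.decode P ρ x h l (N.received P ρ x h l s n) ≠ N.superSymbol l s}) /
    (N.symbolVectors.card : ℝ≥0∞)

/-- The network error rate: the expectation of the conditional network error rate over the channel
state, when the relays use the factor `ρ` and the quantizer `Q`. The conditional rate is at most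
`1`, so that the value is finite; `ρ` and `Q` need not be measurable, since the integral is then
the lower integral. -/
def ner (P : ℝ) (ρ : ChannelState K L R → Fin R → ℝ) (Q : Quantizer K L R) : ℝ :=
  (∫⁻ h, N.cner P (ρ h) (Q.toFun h) h ∂N.channelLaw).toReal

end RelayNetwork

/-- The first-order diversity of the error rate `e`, a function of the power `P`, is `d₁`. -/
def HasFirstOrderDiversity (e : ℝ → ℝ) (d₁ : EReal) : Prop :=
  Tendsto (fun P : ℝ => ((-(Real.log (e P) / Real.log P) : ℝ) : EReal)) atTop (𝓝 d₁)

/-- The second-order diversity of the error rate `e` with first-order diversity `d₁` is `d₂`. -/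
def HasSecondOrderDiversity (e : ℝ → ℝ) (d₁ : ℝ) (d₂ : EReal) : Prop :=
  Tendsto (fun P : ℝ =>
    ((-((Real.log (e P) + d₁ * Real.log P) / Real.log (Real.log P)) : ℝ) : EReal)) atTop (𝓝 d₂)

/-- The diversity of the error rate `e` is not higher than `(a, b)` in the lexicographic order: its
first-order diversity, if it has one, is less than `a`, or it is `a` and the second-order
diversity, if it has one, is at most `b`. -/
def DiversityAtMost (e : ℝ → ℝ) (a b : ℝ) : Prop :=
  ∀ d₁ : EReal, HasFirstOrderDiversity e d₁ →
    d₁ < (a : EReal) ∨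
      (d₁ = (a : EReal) ∧ ∀ d₂ : EReal, HasSecondOrderDiversity e a d₂ → d₂ ≤ (b : EReal))

end

/-! ### Lower bounds for complex Gaussian measures and integrals. -/

noncomputable section

/-! The beamforming vector can be eliminated. Take two symbol vectors that differ only at
transmitter `k`, and a receiver `l` that wants `s_k`. Since `‖x‖ ≤ 1`, the triangle inequality
bounds the distance of their noiseless signals by a sum over the relays of gains that do not involve
`x` (`norm_signal_sub_le_one`). If every gain `ρ_r |f_kr|² P_{S_k} |g_rl|²` is below a fixed `ε`,
this distance is at most `1`. The unit receiver noise then makes the two vectors confusable, and the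
conditional error rate is at least a constant (`exists_le_cner`). Passing to `ρ' ≤ ρ` only lowers
the gains. Hence the error rate is at least a constant times the probability of any measurable event
on which all gains are small (`exists_mul_measureReal_le_ner`), uniformly in the quantizer.

It remains to find likely events of this kind. Always `ρ_r |f_kr|² P_{S_k} ≤ P_{R_r}`, so `|g_rl|² ≤
δ/P` for all `r` suffices; this has probability of order at least `P^{-R}`. If there is a second
transmitter `i`, the interference `|f_ir| ≥ 1` keeps `ρ_r` bounded, and only `|f_kr|² |g_rl|² ≤ δ/P`
is needed. A product of two independent such variables is below `t` with probability of order at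
least `t log(1/t)`, the logarithm being the integral of `1/|z|²` over an annulus; this gives `(log P
/ P)^R`. The diversity claims follow by taking logarithms. -/

instance isProbabilityMeasure_complexGaussian (v : ℝ≥0) :
    IsProbabilityMeasure (complexGaussian v) :=
  Measure.isProbabilityMeasure_map (MeasurableEquiv.measurable _).aemeasurable

/-- On a bounded interval the real Gaussian density is bounded below by a positive constant. -/
theorem exists_le_gaussianPDF {v : ℝ≥0} (hv : v ≠ 0) (M : ℝ) :
    ∃ c : ℝ≥0∞, c ≠ 0 ∧ c ≠ ∞ ∧ ∀ x : ℝ, |x| ≤ M → c ≤ gaussianPDF 0 v x := by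
  -- The density decreases in `|x|`, so its value at the endpoint `M` serves.
  refine ⟨ENNReal.ofReal (gaussianPDFReal 0 v M), ?_, ENNReal.ofReal_ne_top, fun x hx => ?_⟩
  · simpa using gaussianPDFReal_pos 0 v M hv
  · refine ENNReal.ofReal_le_ofReal ?_
    have h : x ^ 2 ≤ M ^ 2 := sq_le_sq' (by linarith [neg_le_of_abs_le hx]) (le_of_abs_le hx)
    simp only [gaussianPDFReal_def, sub_zero]
    gcongr

/-- On a bounded set the complex Gaussian law dominates a multiple of the Lebesgue measure. -/
theorem exists_smul_volume_le_complexGaussian {v : ℝ≥0} (hv : 0 < v) (M : ℝ) :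
    ∃ c : ℝ≥0∞, c ≠ 0 ∧ c ≠ ∞ ∧
      c • volume.restrict (Metric.closedBall (0 : ℂ) M) ≤ complexGaussian v := by
  have hv2 : v / 2 ≠ 0 := by positivity
  obtain ⟨c, hc0, hct, hc⟩ := exists_le_gaussianPDF hv2 M
  refine ⟨c * c, mul_ne_zero hc0 hc0, ENNReal.mul_ne_top hct hct, ?_⟩
  refine Measure.le_iff.2 fun s hs => ?_
  have hm := (measurable_gaussianPDF 0 (v / 2))
  have hvol := Complex.volume_preserving_equiv_real_prod.symm
  have hB : MeasurableSet (Metric.closedBall (0 : ℂ) M) := Metric.isClosed_closedBall.measurableSet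
  rw [complexGaussian, Measure.map_apply (MeasurableEquiv.measurable _) hs,
    gaussianReal_of_var_ne_zero _ hv2, prod_withDensity hm hm,
    withDensity_apply _ ((MeasurableEquiv.measurable _) hs), Measure.smul_apply,
    Measure.restrict_apply hs, ← hvol.measure_preimage (hs.inter hB).nullMeasurableSet,
    smul_eq_mul, ← setLIntegral_const, ← Measure.volume_eq_prod]
  refine (setLIntegral_mono' ((MeasurableEquiv.measurable _) (hs.inter hB)) fun z hz => ?_).trans
    (lintegral_mono_set fun z hz => hz.1)
  have hz2 : ‖Complex.measurableEquivRealProd.symm z‖ ≤ M := by simpa using hz.2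
  exact mul_le_mul' (hc _ ((Complex.abs_re_le_norm _).trans hz2))
    (hc _ ((Complex.abs_im_le_norm _).trans hz2))

/-- The area of the disc is `π t²`, and `t ≤ 1` keeps it where the density is bounded below. -/
theorem exists_mul_sq_le_complexGaussian_closedBall {v : ℝ≥0} (hv : 0 < v) :
    ∃ c : ℝ, 0 < c ∧ ∀ t : ℝ, 0 ≤ t → t ≤ 1 →
      ENNReal.ofReal (c * t ^ 2) ≤ complexGaussian v (Metric.closedBall 0 t) := by
  obtain ⟨c, hc0, hct, hc⟩ := exists_smul_volume_le_complexGaussian hv 1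
  refine ⟨c.toReal * Real.pi, mul_pos (ENNReal.toReal_pos hc0 hct) Real.pi_pos,
    fun t ht0 ht1 => ?_⟩
  refine le_trans (le_of_eq ?_) (hc (Metric.closedBall 0 t))
  rw [Measure.smul_apply, Measure.restrict_apply Metric.isClosed_closedBall.measurableSet,
    Set.inter_eq_left.2 (Metric.closedBall_subset_closedBall ht1), Complex.volume_closedBall,
    mul_assoc, ENNReal.ofReal_mul ENNReal.toReal_nonneg, ENNReal.ofReal_toReal hct, smul_eq_mul,
    mul_comm Real.pi, ENNReal.ofReal_mul (by positivity), ENNReal.ofReal_pow ht0,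
    ← NNReal.coe_real_pi, ENNReal.ofReal_coe_nnreal]

theorem exists_le_complexGaussian_one_le_norm {v : ℝ≥0} (hv : 0 < v) :
    ∃ c : ℝ, 0 < c ∧ ENNReal.ofReal c ≤ complexGaussian v {z | 1 ≤ ‖z‖} := by
  -- The unit disc around `2` lies outside the open unit disc and inside the ball of radius `3`.
  obtain ⟨c, hc0, hct, hc⟩ := exists_smul_volume_le_complexGaussian hv 3
  have h : complexGaussian v {z | 1 ≤ ‖z‖} ≠ 0 := by
    refine fun h0 => ?_
    have h1 := (hc (Metric.ball (2 : ℂ) 1)).trans (measure_mono (t := {z | 1 ≤ ‖z‖}) fun z hz => ?_)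
    · rw [h0, Measure.smul_apply, Measure.restrict_apply Metric.isOpen_ball.measurableSet,
        Set.inter_eq_left.2, Complex.volume_ball] at h1
      · simp [hc0, NNReal.pi_ne_zero] at h1
      · intro z hz
        have := norm_add_le (z - 2) 2
        simp only [Metric.mem_ball, dist_eq_norm, Metric.mem_closedBall, sub_zero] at hz ⊢
        simp at this
        linarith
    · have := norm_sub_norm_le (2 : ℂ) z
      rw [Metric.mem_ball, dist_comm, dist_eq_norm] at hz
      simp at this
      simp only [Set.mem_ofPred_eq]
      linarith
  refine ⟨(complexGaussian v {z | 1 ≤ ‖z‖}).toReal,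
    ENNReal.toReal_pos h (measure_ne_top _ _), ENNReal.ofReal_toReal_le⟩

/-- Integral of `1/|z|²` over an annulus. -/
theorem lintegral_annulus_inv_sq {a : ℝ} (ha : 0 < a) (ha1 : a ≤ 1) :
    ∫⁻ z : ℂ, {z : ℂ | a ≤ ‖z‖ ∧ ‖z‖ ≤ 1}.indicator (fun z => ENNReal.ofReal ((‖z‖ ^ 2)⁻¹)) z =
      ENNReal.ofReal (2 * Real.pi * Real.log a⁻¹) := by
  -- In polar coordinates the Jacobian turns `1/r²` into `1/r`, and the angle contributes `2π`.
  rw [← Complex.lintegral_comp_polarCoord_symm, polarCoord_target, Measure.volume_eq_prod,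
    setLIntegral_prod]
  · have h1 : ∀ x ∈ Set.Ioi (0 : ℝ), ∫⁻ y in Set.Ioo (-Real.pi) Real.pi, ENNReal.ofReal x •
        {z : ℂ | a ≤ ‖z‖ ∧ ‖z‖ ≤ 1}.indicator (fun z => ENNReal.ofReal ((‖z‖ ^ 2)⁻¹))
          (Complex.polarCoord.symm (x, y)) =
        (Set.Icc a 1).indicator (fun x => ENNReal.ofReal (2 * Real.pi * x⁻¹)) x := by
      intro x hx
      have hx0 : 0 < x := hx
      have h2 : ∀ y : ℝ, ENNReal.ofReal x •
          {z : ℂ | a ≤ ‖z‖ ∧ ‖z‖ ≤ 1}.indicator (fun z => ENNReal.ofReal ((‖z‖ ^ 2)⁻¹))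
            (Complex.polarCoord.symm (x, y)) =
          (Set.Icc a 1).indicator (fun x => ENNReal.ofReal (x⁻¹)) x := by
        intro y
        simp only [Set.indicator_apply, Set.mem_ofPred_eq, Complex.norm_polarCoord_symm,
          abs_of_pos hx0, Set.mem_Icc, smul_eq_mul]
        split_ifs
        · rw [← ENNReal.ofReal_mul hx0.le]
          congr 1
          field_simp
        · simp
      simp_rw [h2]
      rw [setLIntegral_const, Real.volume_Ioo]
      simp only [Set.indicator_apply]
      split_ifs
      · rw [← ENNReal.ofReal_mul (by positivity)]
        congr 1
        ring
      · simp
    rw [setLIntegral_congr_fun measurableSet_Ioi h1, lintegral_indicator measurableSet_Icc,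
      Measure.restrict_restrict measurableSet_Icc, Set.inter_eq_left.2
        (show Set.Icc a 1 ⊆ Set.Ioi 0 from fun x hx => ha.trans_le hx.1), ← ofReal_integral_eq_lintegral_ofReal]
    · rw [integral_Icc_eq_integral_Ioc, ← intervalIntegral.integral_of_le ha1,
        intervalIntegral.integral_const_mul, integral_inv_of_pos ha one_pos, one_div]
    · refine ContinuousOn.integrableOn_Icc (continuousOn_const.mul (continuousOn_inv₀.mono ?_))
      exact fun x hx => (ha.trans_le hx.1).ne'
    · refine (ae_restrict_mem measurableSet_Icc).mono fun x hx => ?_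
      have := ha.trans_le hx.1
      simp only [Pi.zero_apply]
      positivity
  · refine AEMeasurable.mul (by fun_prop) ?_
    refine Measurable.aemeasurable ?_
    have hs : MeasurableSet {z : ℂ | a ≤ ‖z‖ ∧ ‖z‖ ≤ 1} := by measurability
    have hp : Measurable (Complex.polarCoord.symm : ℝ × ℝ → ℂ) := by
      have : (Complex.polarCoord.symm : ℝ × ℝ → ℂ) = fun p =>
          (p.1 : ℂ) * (Real.cos p.2 + Real.sin p.2 * Complex.I) := by
        ext p
        simp [Complex.polarCoord_symm_apply]
      rw [this]
      fun_prop
    exact (Measurable.indicator (by fun_prop) hs).comp hp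

/-- The complex Gaussian integral of `1/|z|²` over the annulus `a ≤ |z| ≤ 1` is at least of the
order `log (1 / a)`. -/
theorem exists_le_lintegral_annulus_complexGaussian {v : ℝ≥0} (hv : 0 < v) :
    ∃ c : ℝ, 0 < c ∧ ∀ a : ℝ, 0 < a → a ≤ 1 → ENNReal.ofReal (c * Real.log a⁻¹) ≤
      ∫⁻ z, {z : ℂ | a ≤ ‖z‖ ∧ ‖z‖ ≤ 1}.indicator (fun z => ENNReal.ofReal ((‖z‖ ^ 2)⁻¹)) z
        ∂(complexGaussian v) := by
  obtain ⟨c, hc0, hct, hc⟩ := exists_smul_volume_le_complexGaussian hv 1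
  refine ⟨c.toReal * (2 * Real.pi), by have := ENNReal.toReal_pos hc0 hct; positivity,
    fun a ha ha1 => ?_⟩
  have hs : MeasurableSet {z : ℂ | a ≤ ‖z‖ ∧ ‖z‖ ≤ 1} := by measurability
  refine le_trans (le_of_eq ?_) (lintegral_mono' hc le_rfl)
  rw [lintegral_smul_measure, lintegral_indicator hs, Measure.restrict_restrict hs,
    Set.inter_eq_left.2 (fun z hz => by simpa using hz.2), ← lintegral_indicator hs,
    lintegral_annulus_inv_sq ha ha1, mul_assoc, ENNReal.ofReal_mul ENNReal.toReal_nonneg,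
    ENNReal.ofReal_toReal hct, smul_eq_mul]

/-! ### Confusing two hypotheses in Gaussian noise. -/

/-- Two hypotheses shifted by at most `1` in standard complex Gaussian noise cannot be told apart
reliably: if the sets `A` and `A'` of erroneously decoded values cover the plane, then the sum of
the error probabilities is bounded below. -/
theorem exists_le_complexGaussian_add_of_union_eq_univ :
    ∃ c : ℝ≥0∞, c ≠ 0 ∧ ∀ (A A' : Set ℂ) (m m' : ℂ), MeasurableSet A → MeasurableSet A' →
      A ∪ A' = Set.univ → ‖m - m'‖ ≤ 1 →
        c ≤ complexGaussian 1 {z | m + z ∈ A} + complexGaussian 1 {z | m' + z ∈ A'} := by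
  -- Radius `2`: noise that carries a mean within distance `1` of `m` into the unit ball around `m`
  -- has norm at most `2`.
  obtain ⟨c, hc0, hct, hc⟩ := exists_smul_volume_le_complexGaussian (v := 1) one_pos 2
  refine ⟨c * volume (Metric.closedBall (0 : ℂ) 1), ?_, fun A A' m m' hA hA' hu hm => ?_⟩
  · rw [Complex.volume_closedBall]
    simp [hc0, NNReal.pi_ne_zero]
  have key : ∀ (B : Set ℂ) (w : ℂ), MeasurableSet B → ‖m - w‖ ≤ 1 →
      c * volume (B ∩ Metric.closedBall m 1) ≤ complexGaussian 1 {z | w + z ∈ B} := by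
    intro B w hB hw
    refine le_trans ?_ (hc _)
    have hmeas : MeasurableSet {z | w + z ∈ B} := (measurable_const_add w) hB
    rw [Measure.smul_apply, Measure.restrict_apply hmeas, smul_eq_mul,
      ← measure_preimage_add volume w (B ∩ _)]
    gcongr
    intro z hz
    refine ⟨hz.1, ?_⟩
    have h1 : ‖w + z - m‖ ≤ 1 := by simpa [dist_eq_norm] using hz.2
    have h2 := norm_add_le (w + z - m) (m - w)
    have h3 : w + z - m + (m - w) = z := by ring
    rw [h3] at h2
    simpa using h2.trans (by linarith)
  -- Both error sets are measured inside the same unit ball, which they cover.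
  refine le_trans ?_ (add_le_add (key A m hA (by simp)) (key A' m' hA' hm))
  rw [← mul_add]
  gcongr
  refine le_trans ?_ (measure_union_le _ _)
  rw [← Set.union_inter_distrib_right, hu, Set.univ_inter, Complex.volume_closedBall,
    Complex.volume_closedBall]

/-! ### Measurability of the decoder, and error rates bounded below by probabilities of channel
events. -/

namespace RelayNetwork

variable {K L R : ℕ} (N : RelayNetwork K L R)

instance isProbabilityMeasure_noiseLaw : IsProbabilityMeasure (noiseLaw L R) := by
  unfold noiseLaw
  infer_instance

instance isProbabilityMeasure_channelLaw : IsProbabilityMeasure N.channelLaw := by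
  unfold channelLaw
  infer_instance

theorem constellation_nonempty (k : Fin K) : (N.S k).Nonempty := by
  by_contra hk
  have h1 := N.S_energy k
  rw [Finset.not_nonempty_iff_eq_empty.1 hk] at h1
  simp at h1

theorem symbolVectors_nonempty : N.symbolVectors.Nonempty :=
  Fintype.piFinset_nonempty.2 N.constellation_nonempty

theorem measurable_likelihood (P : ℝ) (ρ : Fin R → ℝ) (x : Fin R → ℂ) (h : ChannelState K L R)
    (l : Fin L) (s : Fin K → ℂ) : Measurable (N.likelihood P ρ x h l s) := by
  unfold likelihood
  fun_prop

theorem measurable_posterior (P : ℝ) (ρ : Fin R → ℝ) (x : Fin R → ℂ) (h : ChannelState K L R)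
    (l : Fin L) (u : N.D l → ℂ) : Measurable (N.posterior P ρ x h l u) := by
  unfold posterior
  exact (Finset.measurable_fun_sum _ fun s _ => N.measurable_likelihood P ρ x h l s).div
    (Finset.measurable_fun_sum _ fun s _ => N.measurable_likelihood P ρ x h l s)

theorem measurableSet_mem_maximizers (P : ℝ) (ρ : Fin R → ℝ) (x : Fin R → ℂ)
    (h : ChannelState K L R) (l : Fin L) (u : N.D l → ℂ) :
    MeasurableSet {y | u ∈ N.maximizers P ρ x h l y} := by
  have : {y | u ∈ N.maximizers P ρ x h l y} = {_y | u ∈ N.superAlphabet l} ∩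
      ⋂ u' ∈ N.superAlphabet l,
        {y | N.posterior P ρ x h l u' y ≤ N.posterior P ρ x h l u y} := by
    ext y
    simp [maximizers]
  rw [this]
  exact (MeasurableSet.const _).inter <| Finset.measurableSet_biInter _ fun u' _ =>
    measurableSet_le (N.measurable_posterior P ρ x h l u') (N.measurable_posterior P ρ x h l u)

/-- Expresses the tie-broken choice by finitely many conditions on `y`, from which measurability of
the error sets follows. -/
theorem decode_eq_iff (P : ℝ) (ρ : Fin R → ℝ) (x : Fin R → ℂ) (h : ChannelState K L R)
    (l : Fin L) (u : N.D l → ℂ) (y : ℂ) :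
    N.decode P ρ x h l y = u ↔ u ∈ N.maximizers P ρ x h l y ∧
      ∀ u' ∈ N.superAlphabet l, u' ∈ N.maximizers P ρ x h l y → (N.tie l).le u u' := by
  let _ := N.tie l
  constructor
  · rintro rfl
    exact ⟨Finset.min'_mem _ _, fun u' _ hu' => Finset.min'_le _ _ hu'⟩
  · rintro ⟨hu, hmin⟩
    refine le_antisymm (Finset.min'_le _ _ hu) (Finset.le_min' _ _ _ fun u' hu' => hmin u' ?_ hu')
    rw [maximizers, Finset.mem_filter] at hu'
    exact hu'.1

theorem measurableSet_decode_ne (P : ℝ) (ρ : Fin R → ℝ) (x : Fin R → ℂ) (h : ChannelState K L R)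
    (l : Fin L) (u : N.D l → ℂ) : MeasurableSet {y | N.decode P ρ x h l y ≠ u} := by
  have hEq : {y | N.decode P ρ x h l y = u} = {y | u ∈ N.maximizers P ρ x h l y} ∩
      ⋂ u' ∈ N.superAlphabet l, {y | u' ∈ N.maximizers P ρ x h l y → (N.tie l).le u u'} := by
    ext y
    simp [N.decode_eq_iff P ρ x h l u y]
  have hm : MeasurableSet {y | N.decode P ρ x h l y = u} := by
    rw [hEq]
    refine (N.measurableSet_mem_maximizers P ρ x h l u).inter
      (Finset.measurableSet_biInter _ fun u' _ => ?_)
    simp only [imp_iff_not_or]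
    exact (N.measurableSet_mem_maximizers P ρ x h l u').compl.union (MeasurableSet.const _)
  exact hm.compl

/-- The law of the relay noises together with one receiver noise. -/
theorem noiseLaw_eq_lintegral (l : Fin L) (m : (Fin R → ℂ) → ℂ) (hm : Measurable m) {A : Set ℂ}
    (hA : MeasurableSet A) :
    noiseLaw L R {n | m n.1 + n.2 l ∈ A} =
      ∫⁻ w, complexGaussian 1 {z | m w + z ∈ A} ∂(Measure.pi fun _ : Fin R => complexGaussian 1) := by
  have hmeas : MeasurableSet {n : NoiseState L R | m n.1 + n.2 l ∈ A} :=
    (show Measurable fun n : NoiseState L R => m n.1 + n.2 l by fun_prop) hA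
  rw [noiseLaw, Measure.prod_apply hmeas]
  refine lintegral_congr fun w => ?_
  have hz : MeasurableSet {z : ℂ | m w + z ∈ A} := (measurable_const_add (m w)) hA
  exact (measurePreserving_eval (fun _ : Fin L => complexGaussian 1) l).measure_preimage
    hz.nullMeasurableSet

/-- If the noiseless signals of two symbol vectors are at distance at most `1` at a receiver that
has to distinguish them, then the conditional network error rate is bounded below. -/
theorem exists_le_cner : ∃ c : ℝ≥0∞, c ≠ 0 ∧ c ≠ ∞ ∧ ∀ (P : ℝ) (ρ : Fin R → ℝ) (x : Fin R → ℂ)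
    (h : ChannelState K L R) (l : Fin L), ∀ s ∈ N.symbolVectors, ∀ s' ∈ N.symbolVectors,
      N.superSymbol l s ≠ N.superSymbol l s' →
      ‖N.signal P ρ x h l s - N.signal P ρ x h l s'‖ ≤ 1 → c ≤ N.cner P ρ x h := by
  classical
  obtain ⟨c, hc0, hc⟩ := exists_le_complexGaussian_add_of_union_eq_univ
  have hc1 : c / (N.symbolVectors.card : ℝ≥0∞) ≠ 0 := ENNReal.div_ne_zero.2 ⟨hc0, by simp⟩
  -- The minimum with `1` makes the constant finite, so that it can later be read as a positive
  -- real.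
  refine ⟨min (c / (N.symbolVectors.card : ℝ≥0∞)) 1,
    (lt_min (pos_iff_ne_zero.2 hc1) one_pos).ne', (min_lt_of_right_lt ENNReal.one_lt_top).ne,
    fun P ρ x h l s hs s' hs' hne hd => (min_le_left _ _).trans ?_⟩
  rw [cner]
  refine ENNReal.div_le_div_right ?_ _
  have hss : s ≠ s' := fun e => hne (by rw [e])
  refine le_trans ?_ (Finset.add_le_sum (fun i _ => zero_le) hs hs' hss)
  let w : (Fin R → ℂ) → ℂ := fun n => ∑ r, x r * h.2 r l * (√(ρ r) : ℂ) * n r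
  have hw : Measurable w := by fun_prop
  let A : (Fin K → ℂ) → Set ℂ := fun s => {y | N.decode P ρ x h l y ≠ N.superSymbol l s}
  have hA : ∀ s, MeasurableSet (A s) := fun s => N.measurableSet_decode_ne P ρ x h l _
  have hle : ∀ s, ∫⁻ n, complexGaussian 1 {z | N.signal P ρ x h l s + w n + z ∈ A s}
      ∂(Measure.pi fun _ : Fin R => complexGaussian 1) ≤
      noiseLaw L R
        {n | ∃ l, N.decode P ρ x h l (N.received P ρ x h l s n) ≠ N.superSymbol l s} := by
    intro s
    rw [← noiseLaw_eq_lintegral (L := L) l (fun n => N.signal P ρ x h l s + w n) (by fun_prop)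
      (hA s)]
    exact measure_mono fun n hn => ⟨l, hn⟩
  refine le_trans ?_ (add_le_add (hle s) (hle s'))
  -- Conditionally on the relay noises, `w n` shifts both means equally, so their distance is that
  -- of the noiseless signals.
  rw [← lintegral_add_left]
  · calc c = ∫⁻ _, c ∂(Measure.pi fun _ : Fin R => complexGaussian 1) := by simp
      _ ≤ _ := lintegral_mono fun n => hc _ _ _ _ (hA s) (hA s') ?_ ?_
    -- The error sets cover the plane because one decoded value cannot equal two distinct
    -- super-symbols.
    · ext y
      by_cases hy : N.decode P ρ x h l y = N.superSymbol l s
      · simp [A, hy, hne]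
      · simp [A, hy]
    · simpa using hd
  · have hm : MeasurableSet {p : (Fin R → ℂ) × ℂ | N.signal P ρ x h l s + w p.1 + p.2 ∈ A s} :=
      (show Measurable fun p : (Fin R → ℂ) × ℂ => N.signal P ρ x h l s + w p.1 + p.2 by
        fun_prop) (hA s)
    exact measurable_measure_prodMk_left hm

theorem cner_le_one (P : ℝ) (ρ : Fin R → ℝ) (x : Fin R → ℂ) (h : ChannelState K L R) :
    N.cner P ρ x h ≤ 1 := by
  rw [cner]
  refine ENNReal.div_le_of_le_mul ?_
  calc _ ≤ ∑ _s ∈ N.symbolVectors, (1 : ℝ≥0∞) := Finset.sum_le_sum fun _ _ => prob_le_one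
    _ = _ := by simp

/-- Restricts the lower integral to `E`. Only `E` has to be measurable, so the quantizer and the
factor may be arbitrary functions of the channel. -/
theorem mul_measureReal_le_ner {P : ℝ} {ρ : ChannelState K L R → Fin R → ℝ}
    {Q : Quantizer K L R} {c : ℝ≥0∞} {E : Set (ChannelState K L R)}
    (hE : MeasurableSet E) (hc : ∀ h ∈ E, c ≤ N.cner P (ρ h) (Q.toFun h) h) :
    c.toReal * N.channelLaw.real E ≤ N.ner P ρ Q := by
  rw [ner, measureReal_def, ← ENNReal.toReal_mul]
  refine ENNReal.toReal_mono (ne_top_of_le_ne_top ENNReal.one_ne_top ?_) ?_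
  · calc _ ≤ ∫⁻ _, 1 ∂N.channelLaw := lintegral_mono fun h => N.cner_le_one P _ _ h
      _ = 1 := by simp
  · rw [← setLIntegral_const]
    exact (setLIntegral_mono' hE hc).trans (setLIntegral_le_lintegral _ _)

end RelayNetwork

/-! ### Gains through the relays, and the event of weak second hops. -/

namespace RelayNetwork

variable {K L R : ℕ} (N : RelayNetwork K L R)

/-- Two symbol vectors that differ only in the symbol of transmitter `k` have noiseless signals at
distance at most `1` if the gain from transmitter `k` to the receiver through each relay is small. -/
theorem norm_signal_sub_le_one {P : ℝ} {ρ : Fin R → ℝ} {x : Fin R → ℂ} {h : ChannelState K L R}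
    {l : Fin L} {k : Fin K} {s s' : Fin K → ℂ} (hP : 0 ≤ P) (hρ : ∀ r, 0 ≤ ρ r) (hx : ‖x‖ ≤ 1)
    (hR : 0 < R) (hk : s k ≠ s' k) (hss : ∀ j, j ≠ k → s j = s' j)
    (hg : ∀ r, ρ r * (‖h.1 k r‖ ^ 2 * (N.pS k * P)) * ‖h.2 r l‖ ^ 2 ≤
      ((R * ‖s k - s' k‖)⁻¹) ^ 2) :
    ‖N.signal P ρ x h l s - N.signal P ρ x h l s'‖ ≤ 1 := by
  have hd : 0 < ‖s k - s' k‖ := norm_pos_iff.2 (sub_ne_zero.2 hk)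
  have hR' : (0 : ℝ) < R := Nat.cast_pos.2 hR
  have hpS : 0 ≤ N.pS k * P := mul_nonneg (N.pS_pos k).le hP
  have heq : N.signal P ρ x h l s - N.signal P ρ x h l s' =
      ∑ r, x r * (√(ρ r) : ℂ) * h.1 k r * h.2 r l * (√(N.pS k * P) : ℂ) * (s k - s' k) := by
    rw [signal, signal, ← Finset.sum_sub_distrib, Finset.sum_eq_single k]
    · rw [← Finset.sum_sub_distrib]
      exact Finset.sum_congr rfl fun r _ => by ring
    · intro j _ hj
      rw [hss j hj, sub_self]
    · simp
  rw [heq]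
  -- The threshold on the gains is chosen so that each of the `R` relays contributes at most `1/R`.
  calc _ ≤ ∑ _r : Fin R, (R : ℝ)⁻¹ := norm_sum_le_of_le _ fun r _ => ?_
    _ = 1 := by simp [hR'.ne']
  have h1 : √(ρ r) * ‖h.1 k r‖ * ‖h.2 r l‖ * √(N.pS k * P) ≤ (R * ‖s k - s' k‖)⁻¹ := by
    refine le_of_sq_le_sq ?_ (by positivity)
    refine le_trans (le_of_eq ?_) (hg r)
    simp only [mul_pow, Real.sq_sqrt (hρ r), Real.sq_sqrt hpS]
    ring
  calc _ = ‖x r‖ * (√(ρ r) * ‖h.1 k r‖ * ‖h.2 r l‖ * √(N.pS k * P)) * ‖s k - s' k‖ := by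
        simp only [norm_mul, Complex.norm_real, Real.norm_eq_abs, abs_of_nonneg (Real.sqrt_nonneg _)]
        ring
    _ ≤ 1 * (R * ‖s k - s' k‖)⁻¹ * ‖s k - s' k‖ := by
        gcongr
        exact (norm_le_pi_norm x r).trans hx
    _ = (R : ℝ)⁻¹ := by field_simp

/-- The power received from transmitter `k` is one summand of the denominator of the relay factor.
-/
theorem relayFactor_mul_le {P : ℝ} (hP : 0 < P) (h : ChannelState K L R) (k : Fin K) (r : Fin R) :
    N.relayFactor P h r * (‖h.1 k r‖ ^ 2 * (N.pS k * P)) ≤ N.pR r * P := by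
  have hs : ‖h.1 k r‖ ^ 2 * (N.pS k * P) ≤ ∑ i, ‖h.1 i r‖ ^ 2 * (N.pS i * P) :=
    Finset.single_le_sum (f := fun i => ‖h.1 i r‖ ^ 2 * (N.pS i * P))
      (fun i _ => by have := N.pS_pos i; positivity) (Finset.mem_univ k)
  have h0 : 0 ≤ ‖h.1 k r‖ ^ 2 * (N.pS k * P) := by have := N.pS_pos k; positivity
  have hpR := N.pR_pos r
  rw [relayFactor, div_mul_eq_mul_div, div_le_iff₀ (by linarith)]
  gcongr
  linarith

/-- A strong interferer makes the denominator at least `pS i * P`, which cancels the `P` in the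
numerator; the bound is uniform in `P`. -/
theorem relayFactor_le_of_one_le {P : ℝ} (hP : 0 < P) (h : ChannelState K L R) (i : Fin K)
    (r : Fin R) (hi : 1 ≤ ‖h.1 i r‖) : N.relayFactor P h r ≤ N.pR r / N.pS i := by
  have hpS := N.pS_pos i
  have hpR := N.pR_pos r
  have hs : ‖h.1 i r‖ ^ 2 * (N.pS i * P) ≤ ∑ i, ‖h.1 i r‖ ^ 2 * (N.pS i * P) :=
    Finset.single_le_sum (f := fun i => ‖h.1 i r‖ ^ 2 * (N.pS i * P))
      (fun i _ => by have := N.pS_pos i; positivity) (Finset.mem_univ i)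
  have h1 : 1 * (N.pS i * P) ≤ ‖h.1 i r‖ ^ 2 * (N.pS i * P) := by
    gcongr
    exact one_le_pow₀ hi
  have h0 : 0 < N.pS i * P := by positivity
  rw [relayFactor, div_le_div_iff₀ (by linarith) hpS]
  calc N.pR r * P * N.pS i = N.pR r * (1 * (N.pS i * P)) := by ring
    _ ≤ _ := by gcongr; linarith

/-- A pair of symbol vectors that differ at a single transmitter, and a receiver that has to
distinguish them. -/
theorem exists_symbolVectors_differing : ∃ (k : Fin K) (l : Fin L), ∃ s ∈ N.symbolVectors,
    ∃ s' ∈ N.symbolVectors, N.superSymbol l s ≠ N.superSymbol l s' ∧ s k ≠ s' k ∧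
      ∀ j, j ≠ k → s j = s' j := by
  obtain ⟨k, hk⟩ := N.S_nontrivial
  obtain ⟨a, ha, b, hb, hab⟩ := Finset.one_lt_card.1 hk
  obtain ⟨l, hl⟩ := N.D_cover k
  obtain ⟨s, hs⟩ := N.symbolVectors_nonempty
  have hmem : ∀ c ∈ N.S k, Function.update s k c ∈ N.symbolVectors := by
    intro c hc
    simp only [symbolVectors, Fintype.mem_piFinset] at hs ⊢
    intro j
    rcases eq_or_ne j k with rfl | hj
    · simpa using hc
    · simpa [hj] using hs j
  refine ⟨k, l, _, hmem a ha, _, hmem b hb, fun e => hab ?_, by simpa using hab,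
    fun j hj => by simp [hj]⟩
  simpa [superSymbol] using congrFun e ⟨k, hl⟩

/-- All channels from the relays to receiver `l` are weak with probability at least of the order
`t ^ R`. -/
theorem exists_le_channelLaw_weak (l : Fin L) : ∃ c : ℝ, 0 < c ∧ ∀ t : ℝ, 0 ≤ t → t ≤ 1 →
    c * t ^ R ≤ N.channelLaw.real {h | ∀ r, ‖h.2 r l‖ ^ 2 ≤ t} := by
  choose c hc0 hc using fun r => exists_mul_sq_le_complexGaussian_closedBall (N.varG_pos r l)
  refine ⟨∏ r, c r, Finset.prod_pos fun r _ => hc0 r, fun t ht0 ht1 => ?_⟩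
  have hset : {h : ChannelState K L R | ∀ r, ‖h.2 r l‖ ^ 2 ≤ t} = Set.univ ×ˢ
      (Set.univ.pi fun r => Function.eval l ⁻¹' Metric.closedBall (0 : ℂ) √t) := by
    ext h
    simp [Real.le_sqrt (norm_nonneg _) ht0]
  have hlaw : N.channelLaw {h | ∀ r, ‖h.2 r l‖ ^ 2 ≤ t} =
      ∏ r, complexGaussian (N.varG r l) (Metric.closedBall 0 √t) := by
    rw [hset, channelLaw, Measure.prod_prod, measure_univ, one_mul, Measure.pi_pi]
    refine Finset.prod_congr rfl fun r _ => ?_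
    exact (measurePreserving_eval (fun l => complexGaussian (N.varG r l)) l).measure_preimage
      Metric.isClosed_closedBall.measurableSet.nullMeasurableSet
  rw [measureReal_def, ← ENNReal.ofReal_le_iff_le_toReal (measure_ne_top _ _), hlaw]
  calc ENNReal.ofReal ((∏ r, c r) * t ^ R) = ∏ r, ENNReal.ofReal (c r * √t ^ 2) := by
        rw [← ENNReal.ofReal_prod_of_nonneg fun r _ => by have := hc0 r; positivity,
          Finset.prod_mul_distrib, Real.sq_sqrt ht0]
        simp
    _ ≤ _ := Finset.prod_le_prod' fun r _ => hc r _ (Real.sqrt_nonneg t) (Real.sqrt_le_one.2 ht1)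

end RelayNetwork

/-! ### Independence, and the event of weak two-hop products under strong interference. -/

theorem lintegral_pi_prod_eq_prod {ι : Type*} [Fintype ι] {E : ι → Type*}
    [∀ i, MeasurableSpace (E i)] (μ : ∀ i, Measure (E i)) [∀ i, IsProbabilityMeasure (μ i)]
    {f : ∀ i, E i → ℝ≥0∞} (hf : ∀ i, Measurable (f i)) :
    ∫⁻ w, ∏ i, f i (w i) ∂(Measure.pi μ) = ∏ i, ∫⁻ z, f i z ∂(μ i) := by
  refine (lintegral_prod_eq_prod_lintegral_of_indepFun Finset.univ
    (fun i (w : ∀ i, E i) => f i (w i)) (iIndepFun_pi fun i => (hf i).aemeasurable)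
    fun i => (hf i).comp (measurable_pi_apply i)).trans ?_
  exact Finset.prod_congr rfl fun i _ => (measurePreserving_eval μ i).lintegral_comp (hf i)

/-- Serves to separate the channel rows of the weak and the strong transmitter; all other rows
integrate out. -/
theorem lintegral_pi_mul_eq_mul {ι : Type*} [Fintype ι] {E : ι → Type*}
    [∀ i, MeasurableSpace (E i)] (μ : ∀ i, Measure (E i)) [∀ i, IsProbabilityMeasure (μ i)]
    {i j : ι} (hij : i ≠ j) {f : E i → ℝ≥0∞} {g : E j → ℝ≥0∞} (hf : Measurable f)
    (hg : Measurable g) :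
    ∫⁻ w, f (w i) * g (w j) ∂(Measure.pi μ) = (∫⁻ z, f z ∂(μ i)) * ∫⁻ z, g z ∂(μ j) := by
  have h1 : iIndepFun (fun i (w : ∀ i, E i) => w i) (Measure.pi μ) :=
    iIndepFun_pi (X := fun _ => id) fun i => aemeasurable_id
  have h2 : (fun w : ∀ i, E i => f (w i)) ⟂ᵢ[Measure.pi μ] fun w => g (w j) :=
    (h1.indepFun hij).comp hf hg
  refine (lintegral_mul_eq_lintegral_mul_lintegral_of_indepFun''
    (hf.comp (measurable_pi_apply i)).aemeasurable (hg.comp (measurable_pi_apply j)).aemeasurable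
    h2).trans ?_
  simp only [Function.comp_apply]
  rw [(measurePreserving_eval μ i).lintegral_comp hf,
    (measurePreserving_eval μ j).lintegral_comp hg]

namespace RelayNetwork

variable {K L R : ℕ} (N : RelayNetwork K L R)

theorem measurableSet_weak_product (k i : Fin K) (l : Fin L) (t : ℝ) :
    MeasurableSet {h : ChannelState K L R |
      ∀ r, ‖h.1 k r‖ ^ 2 * ‖h.2 r l‖ ^ 2 ≤ t ∧ 1 ≤ ‖h.1 i r‖} := by
  have : {h : ChannelState K L R | ∀ r, ‖h.1 k r‖ ^ 2 * ‖h.2 r l‖ ^ 2 ≤ t ∧ 1 ≤ ‖h.1 i r‖} =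
      ⋂ r, {h | ‖h.1 k r‖ ^ 2 * ‖h.2 r l‖ ^ 2 ≤ t} ∩ {h | 1 ≤ ‖h.1 i r‖} := by
    ext h
    simp
  rw [this]
  exact MeasurableSet.iInter fun r => (measurableSet_le (by fun_prop) measurable_const).inter
    (measurableSet_le measurable_const (by fun_prop))

/-- All channels through the relays from transmitter `k` to receiver `l` are weak, while those
from transmitter `i` are strong, with probability at least of the order `(t log (1 / t)) ^ R`. -/
theorem exists_le_channelLaw_weak_product {k i : Fin K} (hki : k ≠ i) (l : Fin L) :
    ∃ c : ℝ, 0 < c ∧ ∀ t : ℝ, 0 < t → t ≤ 1 → c * (t * Real.log t⁻¹) ^ R ≤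
      N.channelLaw.real {h | ∀ r, ‖h.1 k r‖ ^ 2 * ‖h.2 r l‖ ^ 2 ≤ t ∧ 1 ≤ ‖h.1 i r‖} := by
  choose c hc0 hc using fun r => exists_mul_sq_le_complexGaussian_closedBall (N.varG_pos r l)
  choose d hd0 hd using fun r => exists_le_lintegral_annulus_complexGaussian (N.varF_pos k r)
  choose e he0 he using fun r => exists_le_complexGaussian_one_le_norm (N.varF_pos i r)
  -- The factor `1/2` comes from `log (1/√t) = (1/2) log (1/t)`, the annulus having inner radius
  -- `√t`.
  refine ⟨∏ r, c r * (d r / 2) * e r,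
    Finset.prod_pos fun r _ => by have := hc0 r; have := hd0 r; have := he0 r; positivity,
    fun t ht0 ht1 => ?_⟩
  have hlog : 0 ≤ Real.log t⁻¹ := Real.log_nonneg ((one_le_inv₀ ht0).2 ht1)
  have hs0 : 0 < √t := Real.sqrt_pos.2 ht0
  have hs1 : √t ≤ 1 := Real.sqrt_le_one.2 ht1
  rw [measureReal_def, ← ENNReal.ofReal_le_iff_le_toReal (measure_ne_top _ _), channelLaw,
    Measure.prod_apply (measurableSet_weak_product k i l t)]
  -- Given `|f_kr| = a`, the product condition puts `g_rl` in the disc of radius `√t / a`, of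
  -- probability at least `c t / a²`. Requiring `√t ≤ a` keeps this radius at most `1`, as the disc
  -- estimate demands. `φ` carries the factor `1/a²`, and `ψ` the strong channel of transmitter `i`.
  let φ : ℂ → ℝ≥0∞ :=
    {z : ℂ | √t ≤ ‖z‖ ∧ ‖z‖ ≤ 1}.indicator fun z => ENNReal.ofReal ((‖z‖ ^ 2)⁻¹)
  let ψ : ℂ → ℝ≥0∞ := {z : ℂ | 1 ≤ ‖z‖}.indicator 1
  have hφ : Measurable φ := Measurable.indicator (by fun_prop) (by measurability)
  have hm1 : MeasurableSet {z : ℂ | 1 ≤ ‖z‖} := by measurability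
  have hψ : Measurable ψ := measurable_one.indicator hm1
  have hφ' : ∀ r, Measurable fun z => ENNReal.ofReal (c r * t) * φ z := fun r =>
    hφ.const_mul _
  have hslice : ∀ f : Fin K → Fin R → ℂ,
      (∏ r, ENNReal.ofReal (c r * t) * φ (f k r)) * ∏ r, ψ (f i r) ≤
      (Measure.pi fun r => Measure.pi fun l => complexGaussian (N.varG r l))
        (Prod.mk f ⁻¹' {h | ∀ r, ‖h.1 k r‖ ^ 2 * ‖h.2 r l‖ ^ 2 ≤ t ∧ 1 ≤ ‖h.1 i r‖}) := by
    intro f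
    by_cases hf : ∀ r, (√t ≤ ‖f k r‖ ∧ ‖f k r‖ ≤ 1) ∧ 1 ≤ ‖f i r‖
    · have hpos : ∀ r, 0 < ‖f k r‖ := fun r => hs0.trans_le (hf r).1.1
      have hsub : (Set.univ.pi fun r =>
          Function.eval l ⁻¹' Metric.closedBall (0 : ℂ) (√t / ‖f k r‖)) ⊆
          Prod.mk f ⁻¹' {h : ChannelState K L R |
            ∀ r, ‖h.1 k r‖ ^ 2 * ‖h.2 r l‖ ^ 2 ≤ t ∧ 1 ≤ ‖h.1 i r‖} := by
        intro g hg r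
        refine ⟨?_, (hf r).2⟩
        have hgr : ‖g r l‖ ≤ √t / ‖f k r‖ := by simpa using hg r (Set.mem_univ r)
        rw [le_div_iff₀ (hpos r), mul_comm] at hgr
        have := pow_le_pow_left₀ (by positivity) hgr 2
        rwa [mul_pow, Real.sq_sqrt ht0.le] at this
      refine le_trans ?_ (measure_mono hsub)
      rw [Measure.pi_pi, ← Finset.prod_mul_distrib]
      refine Finset.prod_le_prod' fun r _ => ?_
      rw [(measurePreserving_eval (fun l => complexGaussian (N.varG r l)) l).measure_preimage
        Metric.isClosed_closedBall.measurableSet.nullMeasurableSet]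
      have h1 : φ (f k r) = ENNReal.ofReal ((‖f k r‖ ^ 2)⁻¹) :=
        Set.indicator_of_mem (show f k r ∈ {z : ℂ | √t ≤ ‖z‖ ∧ ‖z‖ ≤ 1} from (hf r).1) _
      have h2 : ψ (f i r) = 1 :=
        Set.indicator_of_mem (show f i r ∈ {z : ℂ | 1 ≤ ‖z‖} from (hf r).2) _
      rw [h1, h2, mul_one, ← ENNReal.ofReal_mul (mul_nonneg (hc0 r).le ht0.le)]
      refine le_trans (le_of_eq ?_) (hc r (√t / ‖f k r‖) (by positivity)
        ((div_le_one (hpos r)).2 (hf r).1.1))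
      rw [div_pow, Real.sq_sqrt ht0.le, mul_assoc, div_eq_mul_inv]
    · obtain ⟨r, hr⟩ := not_forall.1 hf
      refine le_trans (le_of_eq ?_) zero_le
      rw [← Finset.prod_mul_distrib]
      refine Finset.prod_eq_zero (Finset.mem_univ r) ?_
      rcases not_and_or.1 hr with hr | hr
      · rw [show φ (f k r) = 0 from Set.indicator_of_notMem
          (show f k r ∉ {z : ℂ | √t ≤ ‖z‖ ∧ ‖z‖ ≤ 1} from hr) _, mul_zero, zero_mul]
      · rw [show ψ (f i r) = 0 from Set.indicator_of_notMem
          (show f i r ∉ {z : ℂ | 1 ≤ ‖z‖} from hr) _, mul_zero]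
  refine le_trans ?_ (lintegral_mono hslice)
  rw [lintegral_pi_mul_eq_mul (fun k => Measure.pi fun r => complexGaussian (N.varF k r)) hki
    (f := fun w => ∏ r, ENNReal.ofReal (c r * t) * φ (w r)) (g := fun w => ∏ r, ψ (w r))
    (Finset.measurable_fun_prod _ fun r _ => (hφ' r).comp (measurable_pi_apply r))
    (Finset.measurable_fun_prod _ fun r _ => hψ.comp (measurable_pi_apply r)),
    lintegral_pi_prod_eq_prod _ hφ', lintegral_pi_prod_eq_prod _ fun _ => hψ,
    ← Finset.prod_mul_distrib]
  calc _ = ∏ r, ENNReal.ofReal (c r * t) * ENNReal.ofReal (d r * Real.log (√t)⁻¹) *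
        ENNReal.ofReal (e r) := by
        have h0 : ∀ r, 0 ≤ c r * (d r / 2) * e r * (t * Real.log t⁻¹) := fun r => by
          have := hc0 r; have := hd0 r; have := he0 r; positivity
        have hconst : (t * Real.log t⁻¹) ^ R = ∏ _r : Fin R, t * Real.log t⁻¹ := by simp
        rw [hconst, ← Finset.prod_mul_distrib, ENNReal.ofReal_prod_of_nonneg fun r _ => h0 r]
        refine Finset.prod_congr rfl fun r _ => ?_
        have h1 := hc0 r
        have h2 := hd0 r
        have h3 := he0 r
        have h4 : 0 ≤ Real.log (√t)⁻¹ := Real.log_nonneg ((one_le_inv₀ hs0).2 hs1)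
        rw [← ENNReal.ofReal_mul (by positivity), ← ENNReal.ofReal_mul (by positivity)]
        congr 1
        rw [Real.log_inv, Real.log_inv, Real.log_sqrt ht0.le]
        ring
    _ ≤ _ := Finset.prod_le_prod' fun r _ => by
        rw [lintegral_const_mul _ hφ]
        refine mul_le_mul' (mul_le_mul' le_rfl (hd r _ hs0 hs1)) ?_
        rw [lintegral_indicator_one hm1]
        exact he r

end RelayNetwork

/-! ### Lower bounds for the network error rate. -/

namespace RelayNetwork

variable {K L R : ℕ} (N : RelayNetwork K L R)

/-- The network error rate is at least of the order of the probability that the gains from one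
transmitter to one receiver through the relays are all bounded. -/
theorem exists_mul_measureReal_le_ner (hR : 0 < R) : ∃ (k : Fin K) (l : Fin L) (ε c : ℝ),
    0 < ε ∧ 0 < c ∧ ∀ (P : ℝ) (Q : Quantizer K L R) (ρ' : ChannelState K L R → Fin R → ℝ)
      (E : Set (ChannelState K L R)), 0 < P → N.IsAdmissibleFactor P ρ' → MeasurableSet E →
      (∀ h ∈ E, ∀ r, N.relayFactor P h r * (‖h.1 k r‖ ^ 2 * (N.pS k * P)) * ‖h.2 r l‖ ^ 2 ≤ ε) →
      c * N.channelLaw.real E ≤ N.ner P ρ' Q := by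
  obtain ⟨k, l, s, hs, s', hs', hne, hk, hss⟩ := N.exists_symbolVectors_differing
  obtain ⟨c, hc0, hct, hc⟩ := N.exists_le_cner
  have hd : 0 < ‖s k - s' k‖ := norm_pos_iff.2 (sub_ne_zero.2 hk)
  have hR' : (0 : ℝ) < R := Nat.cast_pos.2 hR
  refine ⟨k, l, ((R * ‖s k - s' k‖)⁻¹) ^ 2, c.toReal, by positivity, ENNReal.toReal_pos hc0 hct,
    fun P Q ρ' E hP hρ hE hg => N.mul_measureReal_le_ner hE fun h hh => ?_⟩
  refine hc P _ _ h l s hs s' hs' hne (N.norm_signal_sub_le_one hP.le (fun r => (hρ h r).1)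
    (Q.codebook_subset (Q.toFun_mem h)) hR hk hss fun r => le_trans ?_ (hg h hh r))
  -- Replacing `ρ'` by the larger `ρ` makes the event independent of the factor in use.
  have := N.pS_pos k
  gcongr
  exact (hρ h r).2

/-- Supplies the scale of the threshold `δ / P`, common to all relays; `δ ≤ 1` keeps it in the range
`t ≤ 1` of the probability estimates when `P ≥ 1`. -/
theorem exists_forall_mul_le (b : Fin R → ℝ) {ε : ℝ} (hε : 0 < ε) :
    ∃ δ : ℝ, 0 < δ ∧ δ ≤ 1 ∧ ∀ r, b r * δ ≤ ε := by
  have h1 : ∀ᶠ δ : ℝ in 𝓝[>] 0, ∀ r, b r * δ ≤ ε := by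
    refine eventually_all.2 fun r => nhdsWithin_le_nhds ?_
    have : Tendsto (fun δ : ℝ => b r * δ) (𝓝 0) (𝓝 0) := by
      simpa using (tendsto_id (x := 𝓝 (0 : ℝ))).const_mul (b r)
    exact this.eventually_le_const hε
  have h2 : ∀ᶠ δ : ℝ in 𝓝[>] 0, δ ≤ 1 := nhdsWithin_le_nhds (eventually_le_nhds one_pos)
  obtain ⟨δ, ⟨h1, h2⟩, h3⟩ := ((h1.and h2).and self_mem_nhdsWithin).exists
  exact ⟨δ, h3, h2, h1⟩

/-- For any number of transmitters, the network error rate is at least of the order `P ^ (-R)`. -/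
theorem exists_div_pow_le_ner (hR : 0 < R) : ∃ C : ℝ, 0 < C ∧ ∀ P : ℝ, 1 ≤ P →
    ∀ (Q : Quantizer K L R) (ρ' : ChannelState K L R → Fin R → ℝ),
      N.IsAdmissibleFactor P ρ' → C * (1 / P ^ R) ≤ N.ner P ρ' Q := by
  obtain ⟨k, l, ε, c, hε, hc0, hc⟩ := N.exists_mul_measureReal_le_ner hR
  obtain ⟨δ, hδ0, hδ1, hδ⟩ := exists_forall_mul_le N.pR hε
  obtain ⟨d, hd0, hd⟩ := N.exists_le_channelLaw_weak l
  refine ⟨c * (d * δ ^ R), by positivity, fun P hP Q ρ' hρ => ?_⟩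
  have hP0 : 0 < P := one_pos.trans_le hP
  have hset : {h : ChannelState K L R | ∀ r, ‖h.2 r l‖ ^ 2 ≤ δ / P} =
      ⋂ r, {h | ‖h.2 r l‖ ^ 2 ≤ δ / P} := by
    ext h
    simp
  refine le_trans ?_ (hc P Q ρ' {h | ∀ r, ‖h.2 r l‖ ^ 2 ≤ δ / P} hP0 hρ ?_ fun h hh r => ?_)
  · calc _ = c * (d * (δ / P) ^ R) := by
          rw [div_pow]
          ring
      _ ≤ _ := by
          gcongr
          exact hd _ (by positivity) ((div_le_one hP0).2 (hδ1.trans hP))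
  · rw [hset]
    exact MeasurableSet.iInter fun r => measurableSet_le (by fun_prop) measurable_const
  · have hpR := N.pR_pos r
    calc _ ≤ N.pR r * P * (δ / P) :=
          mul_le_mul (N.relayFactor_mul_le hP0 h k r) (hh r) (by positivity) (by positivity)
      _ = N.pR r * δ := by field_simp
      _ ≤ ε := hδ r

/-- With at least two transmitters, the network error rate is at least of the order
`(log P / P) ^ R`. -/
theorem exists_log_pow_div_pow_le_ner (hR : 0 < R) (hK : 1 < K) : ∃ C : ℝ, 0 < C ∧
    ∀ P : ℝ, 1 ≤ P → ∀ (Q : Quantizer K L R) (ρ' : ChannelState K L R → Fin R → ℝ),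
      N.IsAdmissibleFactor P ρ' → C * (Real.log P ^ R / P ^ R) ≤ N.ner P ρ' Q := by
  obtain ⟨k, l, ε, c, hε, hc0, hc⟩ := N.exists_mul_measureReal_le_ner hR
  have : Nontrivial (Fin K) := Fin.nontrivial_iff_two_le.2 hK
  obtain ⟨i, hik⟩ := exists_ne k
  obtain ⟨δ, hδ0, hδ1, hδ⟩ := exists_forall_mul_le (fun r => N.pR r / N.pS i * N.pS k) hε
  obtain ⟨d, hd0, hd⟩ := N.exists_le_channelLaw_weak_product hik.symm l
  refine ⟨c * (d * δ ^ R), by positivity, fun P hP Q ρ' hρ => ?_⟩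
  have hP0 : 0 < P := one_pos.trans_le hP
  refine le_trans ?_ (hc P Q ρ' _ hP0 hρ (measurableSet_weak_product k i l (δ / P))
    fun h hh r => ?_)
  · have hlog : Real.log P ≤ Real.log (δ / P)⁻¹ := by
      refine Real.log_le_log hP0 ?_
      rw [inv_div, le_div_iff₀ hδ0]
      exact mul_le_of_le_one_right hP0.le hδ1
    have hlog0 := Real.log_nonneg hP
    calc _ = c * (d * (δ / P * Real.log P) ^ R) := by
          rw [mul_pow, div_pow]
          ring
      _ ≤ c * (d * (δ / P * Real.log (δ / P)⁻¹) ^ R) := by gcongr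
      _ ≤ _ := by
          gcongr
          exact hd _ (by positivity) ((div_le_one hP0).2 (hδ1.trans hP))
  · have hpR := N.pR_pos r
    have hpS := N.pS_pos k
    have hpSi := N.pS_pos i
    obtain ⟨h1, h2⟩ := hh r
    calc N.relayFactor P h r * (‖h.1 k r‖ ^ 2 * (N.pS k * P)) * ‖h.2 r l‖ ^ 2
        = N.relayFactor P h r * (N.pS k * P) * (‖h.1 k r‖ ^ 2 * ‖h.2 r l‖ ^ 2) := by ring
      _ ≤ N.pR r / N.pS i * (N.pS k * P) * (δ / P) := by
          gcongr
          exact N.relayFactor_le_of_one_le hP0 h i r h2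
      _ = N.pR r / N.pS i * N.pS k * δ := by field_simp
      _ ≤ ε := hδ r

end RelayNetwork

/-! ### From error bounds to diversity. -/

/-- An error rate that is at least of the order `(log P) ^ m / P ^ n` has diversity at most
`(n, -m)`. -/
theorem diversityAtMost_of_eventually_le {e : ℝ → ℝ} {C : ℝ} {m n : ℕ} (hC : 0 < C)
    (he : ∀ᶠ P : ℝ in atTop, C * (Real.log P ^ m / P ^ n) ≤ e P) :
    DiversityAtMost e n (-m) := by
  have hlog : Tendsto (fun P : ℝ => Real.log P) atTop atTop := Real.tendsto_log_atTop
  have hloglog : Tendsto (fun P : ℝ => Real.log (Real.log P)) atTop atTop := hlog.comp hlog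
  have hlow : ∀ᶠ P : ℝ in atTop, Real.log C + m * Real.log (Real.log P) - n * Real.log P ≤
      Real.log (e P) := by
    filter_upwards [he, eventually_gt_atTop 0, hlog.eventually_gt_atTop 0] with P h1 h2 h3
    refine le_trans (le_of_eq ?_) (Real.log_le_log (by positivity) h1)
    rw [Real.log_mul hC.ne' (by positivity), Real.log_div (by positivity) (by positivity),
      Real.log_pow, Real.log_pow]
    ring
  intro d₁ hd₁
  have hle : d₁ ≤ (n : ℝ) := by
    have hlim : Tendsto (fun P : ℝ => (n : ℝ) - (Real.log C / Real.log P +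
        m * (Real.log (Real.log P) / Real.log P))) atTop (𝓝 n) := by
      have h1 : Tendsto (fun P : ℝ => Real.log C / Real.log P) atTop (𝓝 0) :=
        hlog.const_div_atTop _
      have h2 : Tendsto (fun P : ℝ => Real.log (Real.log P) / Real.log P) atTop (𝓝 0) :=
        Real.isLittleO_log_id_atTop.tendsto_div_nhds_zero.comp hlog
      simpa using (h1.add (h2.const_mul (m : ℝ))).const_sub (n : ℝ)
    refine le_of_tendsto_of_tendsto hd₁ ((continuous_coe_real_ereal.tendsto _).comp hlim) ?_
    filter_upwards [hlow, hlog.eventually_gt_atTop 0] with P h1 h2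
    refine EReal.coe_le_coe_iff.2 ?_
    have h3 : (Real.log C + m * Real.log (Real.log P) - n * Real.log P) / Real.log P ≤
        Real.log (e P) / Real.log P := by gcongr
    have h4 : (Real.log C + m * Real.log (Real.log P) - n * Real.log P) / Real.log P =
        Real.log C / Real.log P + m * (Real.log (Real.log P) / Real.log P) - n := by
      field_simp
    linarith
  -- When `d₁ = n`, the terms `n log P` cancel, and dividing by `log log P` leaves `m` plus a
  -- vanishing constant term.
  refine hle.lt_or_eq.imp id fun hd => ⟨hd, fun d₂ hd₂ => ?_⟩
  have hlim : Tendsto (fun P : ℝ => -(m : ℝ) - Real.log C / Real.log (Real.log P)) atTop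
      (𝓝 (-m)) := by
    simpa using (hloglog.const_div_atTop (Real.log C)).const_sub (-(m : ℝ))
  refine le_of_tendsto_of_tendsto hd₂ ((continuous_coe_real_ereal.tendsto _).comp hlim) ?_
  filter_upwards [hlow, hloglog.eventually_gt_atTop 0] with P h1 h2
  refine EReal.coe_le_coe_iff.2 ?_
  have h3 : (Real.log C + m * Real.log (Real.log P)) / Real.log (Real.log P) ≤
      (Real.log (e P) + n * Real.log P) / Real.log (Real.log P) :=
    (div_le_div_iff_of_pos_right h2).2 (by linarith)
  have h4 : (Real.log C + m * Real.log (Real.log P)) / Real.log (Real.log P) =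
      Real.log C / Real.log (Real.log P) + m := by field_simp
  linarith

end

theorem theorem1 {K L R : ℕ} (hR : 0 < R) (N : RelayNetwork K L R) :
    (K = 1 →
      (∃ C₁ : ℝ, 0 < C₁ ∧ ∃ P₀ : ℝ, ∀ P : ℝ, P₀ ≤ P →
        ∀ (Q : Quantizer K L R) (ρ' : ChannelState K L R → Fin R → ℝ),
          N.IsAdmissibleFactor P ρ' → C₁ * (1 / P ^ R) ≤ N.ner P ρ' Q) ∧
      (∀ (Q : ℝ → Quantizer K L R) (ρ' : ℝ → ChannelState K L R → Fin R → ℝ),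
        (∀ P : ℝ, 0 < P → N.IsAdmissibleFactor P (ρ' P)) →
          DiversityAtMost (fun P => N.ner P (ρ' P) (Q P)) R 0)) ∧
    (1 < K →
      (∃ C₂ : ℝ, 0 < C₂ ∧ ∃ P₀ : ℝ, ∀ P : ℝ, P₀ ≤ P →
        ∀ (Q : Quantizer K L R) (ρ' : ChannelState K L R → Fin R → ℝ),
          N.IsAdmissibleFactor P ρ' → C₂ * (Real.log P ^ R / P ^ R) ≤ N.ner P ρ' Q) ∧
      (∀ (Q : ℝ → Quantizer K L R) (ρ' : ℝ → ChannelState K L R → Fin R → ℝ),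
        (∀ P : ℝ, 0 < P → N.IsAdmissibleFactor P (ρ' P)) →
          DiversityAtMost (fun P => N.ner P (ρ' P) (Q P)) R (-R))) := by
  refine ⟨fun _ => ?_, fun hK => ?_⟩
  · obtain ⟨C, hC, h⟩ := N.exists_div_pow_le_ner hR
    refine ⟨⟨C, hC, 1, h⟩, fun Q ρ' hρ => ?_⟩
    -- With `m = 0` there is no logarithmic factor, and the second-order bound is `-0`.
    have := diversityAtMost_of_eventually_le (e := fun P => N.ner P (ρ' P) (Q P)) (m := 0) (n := R)
      hC ((eventually_ge_atTop 1).mono fun P hP => by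
        simpa using h P hP (Q P) (ρ' P) (hρ P (one_pos.trans_le hP)))
    simpa using this
  · obtain ⟨C, hC, h⟩ := N.exists_log_pow_div_pow_le_ner hR hK
    exact ⟨⟨C, hC, 1, h⟩, fun Q ρ' hρ => diversityAtMost_of_eventually_le hC
      ((eventually_ge_atTop 1).mono fun P hP =>
        h P hP (Q P) (ρ' P) (hρ P (one_pos.trans_le hP)))⟩
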